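/- Let a \emph{triangle stream} be a sequence $\mathcal T=(T_1,\dots,T_m)$ of distinct triangles (3-element sets of nodes, each regarded as a $K_3$) such that consecutive triangles $T_i,T_{i+1}$ share an edge $e_i$ and the edges $e_1,\dots,e_{m-1}$ are pairwise distinct. Let $G(\mathcal T)$ be the graph that is the union of the triangles $T_i$. A node $u$ of $T_i$ is a \emph{pendant} of $T_i$ if the edge of $T_i$ opposite to $u$ is also an edge of another triangle of $\mathcal T$. \begin{itemize} \item $G(\mathcal T)$ is a \emph{triangle cycle} if $T_m$ and $T_1$ also share an edge, and this edge is different from $e_1,\dots,e_{m-1}$. \item $G(\mathcal T)$ is a \emph{triangle circuit} if $\mathcal T$ does not form a triangle cycle, $T_1$ and $T_m$ each have a unique pendant, these two pendants are the same node $x$, and $x$ belongs to no triangle other than $T_1$ and $T_m$. \item $G(\mathcal T)$ is a \emph{triangle chain} if $T_1$ has a unique pendant $a$, $T_m$ has a unique pendant $b$, $a\neq b$, and $a$ (respectively $b$) belongs to no triangle other than $T_1$ (respectively $T_m$). In that case the graph $G(\mathcal T)\cup\{ab\}$ obtained by adding the edge $ab$ is a \emph{triangle bridge}. \end{itemize}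 A graph $G=(V,E)$ is \emph{generically globally rigid} in the plane if for every $p:V\to\mathbb R^2$ whose family of $2|V|$ coordinates is algebraically independent (no nonzero polynomial with integer coefficients vanishes at it) and every $q:V\to\mathbb R^2$ with $|q(u)-q(v)|=|p(u)-p(v)|$ for all $uv\in E$, one has $|q(u)-q(v)|=|p(u)-p(v)|$ for all $u,v\in V$. Then every triangle cycle, every triangle circuit and every triangle bridge is generically globally rigid in the plane. -/

import Mathlib

/-- A planar configuration is generic if the family of all its coordinates is algebraically
independent: no nonzero polynomial with integer coefficients vanishes at them. -/
def IsGenericConfig {V : Type*} (p : V → EuclideanSpace ℝ (Fin 2)) : Prop :=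
  AlgebraicIndependent ℤ (fun c : V × Fin 2 => p c.1 c.2)

/-- `(G, p)` and `(G, q)` have the same edge lengths, i.e. `p` and `q` are realizations of the
same distance graph with underlying graph `G`. -/
def SameEdgeLengths {V : Type*} (G : SimpleGraph V) (p q : V → EuclideanSpace ℝ (Fin 2)) : Prop :=
  ∀ u v : V, G.Adj u v → dist (p u) (p v) = dist (q u) (q v)

/-- Congruence: all pairwise distances agree. -/
def CongruentConfigs {V : Type*} (p q : V → EuclideanSpace ℝ (Fin 2)) : Prop :=
  ∀ u v : V, dist (p u) (p v) = dist (q u) (q v)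

/-- Generic global rigidity in the plane: every realization `q` (generic or not, injective or
not) with the edge lengths of a generic `p` is congruent to `p`. -/
def GenericallyGloballyRigid {V : Type*} (G : SimpleGraph V) : Prop :=
  ∀ p q : V → EuclideanSpace ℝ (Fin 2),
    IsGenericConfig p → SameEdgeLengths G p q → CongruentConfigs p q

section Triangles

variable {V : Type*} [DecidableEq V] {n : ℕ}

/-- A triangle stream `T 0, …, T n` (so `n + 1` triangles, given by their vertex sets): distinct
triangles, consecutive ones share an edge, and the shared edges are pairwise distinct. Distinct
triangles share an edge iff their vertex sets meet in two points. -/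
structure IsTriangleStream (T : Fin (n + 1) → Finset V) : Prop where
  card_eq : ∀ i, (T i).card = 3
  distinct : Function.Injective T
  share : ∀ i : Fin n, (T i.castSucc ∩ T i.succ).card = 2
  share_distinct : Function.Injective (fun i : Fin n => T i.castSucc ∩ T i.succ)

/-- The union of the triangles of `T`, as a graph. -/
def unionGraph (T : Fin (n + 1) → Finset V) : SimpleGraph V where
  Adj u v := u ≠ v ∧ ∃ i, u ∈ T i ∧ v ∈ T i
  symm := ⟨fun _ _ h => ⟨h.1.symm, h.2.imp fun _ hi => ⟨hi.2, hi.1⟩⟩⟩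
  loopless := ⟨fun _ h => h.1 rfl⟩

/-- Every vertex of `V` is a node of some triangle of `T`. -/
def Covers (T : Fin (n + 1) → Finset V) : Prop := ∀ v : V, ∃ i, v ∈ T i

/-- `u` is a pendant of the triangle `T i`: the edge of `T i` opposite to `u` is shared by
another triangle of `T`. -/
def IsPendant (T : Fin (n + 1) → Finset V) (i : Fin (n + 1)) (u : V) : Prop :=
  u ∈ T i ∧ ∃ j, j ≠ i ∧ (T i).erase u ⊆ T j

/-- `u` is the unique pendant of the triangle `T i`. -/
def IsUniquePendant (T : Fin (n + 1) → Finset V) (i : Fin (n + 1)) (u : V) : Prop :=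
  IsPendant T i u ∧ ∀ w, IsPendant T i w → w = u

/-- The stream of a triangle cycle: the first and the last triangle also share an edge, different
from the edges shared by consecutive triangles. -/
structure IsCycleStream (T : Fin (n + 1) → Finset V) : Prop where
  stream : IsTriangleStream T
  close : (T (Fin.last n) ∩ T 0).card = 2
  close_ne : ∀ i : Fin n, T (Fin.last n) ∩ T 0 ≠ T i.castSucc ∩ T i.succ

/-- The stream of a triangle circuit with circuit knot `x`: it is not the stream of a triangle
cycle, `x` is the unique pendant of the first and of the last triangle, and `x` is a node of no
other triangle. -/
structure IsCircuitStream (T : Fin (n + 1) → Finset V) (x : V) : Prop where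
  stream : IsTriangleStream T
  not_cycle : ¬ IsCycleStream T
  first : IsUniquePendant T 0 x
  last : IsUniquePendant T (Fin.last n) x
  only : ∀ i, x ∈ T i → i = 0 ∨ i = Fin.last n

/-- The stream of a triangle chain with end pendants `a` and `b`: these are the unique pendants
of the first and the last triangle, they are distinct, and neither is a node of another triangle
(weaker than asking all `n + 3` nodes of the `n + 1` triangles to be distinct). -/
structure IsChainStream (T : Fin (n + 1) → Finset V) (a b : V) : Prop where
  stream : IsTriangleStream T
  first : IsUniquePendant T 0 a
  last : IsUniquePendant T (Fin.last n) b
  ne : a ≠ b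
  first_only : ∀ i, a ∈ T i → i = 0
  last_only : ∀ i, b ∈ T i → i = Fin.last n

end Triangles

/-- `G` is a triangle cycle. -/
def IsTriangleCycle {V : Type*} [DecidableEq V] (G : SimpleGraph V) : Prop :=
  ∃ (n : ℕ) (T : Fin (n + 1) → Finset V), IsCycleStream T ∧ Covers T ∧ G = unionGraph T

/-- `G` is a triangle circuit. -/
def IsTriangleCircuit {V : Type*} [DecidableEq V] (G : SimpleGraph V) : Prop :=
  ∃ (n : ℕ) (T : Fin (n + 1) → Finset V) (x : V),
    IsCircuitStream T x ∧ Covers T ∧ G = unionGraph T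

/-- `G` is a triangle bridge: a triangle chain together with the edge joining its two end
pendants. -/
def IsTriangleBridge {V : Type*} [DecidableEq V] (G : SimpleGraph V) : Prop :=
  ∃ (n : ℕ) (T : Fin (n + 1) → Finset V) (a b : V),
    IsChainStream T a b ∧ Covers T ∧ G = unionGraph T ⊔ SimpleGraph.edge a b

/-! Write the points of a generic configuration as complex numbers `z v`. The `z v` and their
conjugates are then algebraically independent over `ℚ`, so they can be treated as independent
variables.

Move the second realization by an isometry so that it agrees with the first on the initial triangle.
Along the strip, each new vertex has two possible positions, mirror images in the shared edge, so
the realization either continues or folds there. Hence on each triangle it is `α z + t` or `α z̄ +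
t`, where `α` is a product of factors `((a - b) / (ā - b̄))^{±1}` over the folded edges
(`exists_folding`). For distinct edges these factors are multiplicatively independent
(`eq_empty_of_prod_edgeRatio_eq_one`), so `α = 1` rules out every fold.

It remains to obtain `α = 1`. In a cycle, the isometry returns to the initial triangle and fixes
three generic points. In a circuit, it fixes the knot, which is independent of `α` and `t`. In a
bridge, the length of `ab` forces `a` to be fixed, because `b` is independent of everything else in
that equation; then the circuit argument applies to `a`. -/

open ComplexConjugate

/-! ### Complex coordinates of a generic configuration -/

/-- The conjugate coordinates of a configuration of complex points: the point itself at `true`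
and its conjugate at `false`. -/
noncomputable def conjCoord {V : Type*} (z : V → ℂ) (v : V) (s : Bool) : ℂ :=
  if s then z v else conj (z v)

@[simp] lemma conjCoord_true {V : Type*} (z : V → ℂ) (v : V) : conjCoord z v true = z v := rfl

@[simp] lemma conjCoord_false {V : Type*} (z : V → ℂ) (v : V) :
    conjCoord z v false = conj (z v) := rfl

@[simp] lemma conj_conjCoord {V : Type*} (z : V → ℂ) (v : V) (s : Bool) :
    conj (conjCoord z v s) = conjCoord z v (!s) := by
  cases s <;> simp

/-- The points of the plane as complex numbers. -/
noncomputable def planeToComplex (x : EuclideanSpace ℝ (Fin 2)) : ℂ := ⟨x 0, x 1⟩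

lemma dist_eq_norm_planeToComplex (x y : EuclideanSpace ℝ (Fin 2)) :
    dist x y = ‖planeToComplex x - planeToComplex y‖ := by
  rw [EuclideanSpace.dist_eq, Complex.norm_eq_sqrt_sq_add_sq]
  simp [planeToComplex, Real.dist_eq, Fin.sum_univ_two, sq_abs]

open MvPolynomial in
/-- Over a domain with a square root of `-1` and `1/2`, the substitution
`(X, Y) ↦ (X + iY, X - iY)` is injective on polynomials. -/
lemma algebraicIndependent_conj_substitution {V K : Type*} [Field K] [CharZero K] (I : K)
    (hI : I * I = -1) :
    AlgebraicIndependent K (fun c : V × Fin 2 =>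
      (if c.2 = 0 then X (c.1, 0) + C I * X (c.1, 1) else X (c.1, 0) - C I * X (c.1, 1) :
        MvPolynomial (V × Fin 2) K)) := by
  -- The inverse substitution `X ↦ (X + Y)/2`, `Y ↦ -i(X - Y)/2`.
  let g : MvPolynomial (V × Fin 2) K →ₐ[K] MvPolynomial (V × Fin 2) K :=
    aeval (fun c : V × Fin 2 => if c.2 = 0 then C (1 / 2) * (X (c.1, 0) + X (c.1, 1))
      else C (-I / 2) * (X (c.1, 0) - X (c.1, 1)))
  refine Function.LeftInverse.injective (g := g) fun P => ?_
  rw [← AlgHom.comp_apply]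
  conv_rhs => rw [← AlgHom.id_apply (R := K) P]
  congr 1
  ext1 c
  obtain ⟨v, i⟩ := c
  have h2 : (C (1 / 2) : MvPolynomial (V × Fin 2) K) * 2 = 1 := by
    rw [← map_ofNat C, ← map_mul]; norm_num
  have hII : (C I : MvPolynomial (V × Fin 2) K) * C (-I / 2) = C (1 / 2) := by
    rw [← map_mul]; congr 1; linear_combination (-1 / 2 : K) * hI
  have hg0 : g (X (v, 0)) = C (1 / 2) * (X (v, 0) + X (v, 1)) := by simp [g]
  have hg1 : g (X (v, 1)) = C (-I / 2) * (X (v, 0) - X (v, 1)) := by simp [g]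
  have hgC : ∀ a : K, g (C a) = C a := fun a => by simp [g]
  fin_cases i
  · simp only [AlgHom.comp_apply, aeval_X, Fin.zero_eta, if_true, map_add, map_mul, hg0, hg1, hgC,
      AlgHom.id_apply]
    linear_combination (X (v, 0) - X (v, 1)) * hII + X (v, 0) * h2
  · simp only [AlgHom.comp_apply, aeval_X, Fin.mk_one, one_ne_zero, if_false, map_sub, map_mul,
      hg0, hg1, hgC, AlgHom.id_apply]
    linear_combination -(X (v, 0) - X (v, 1)) * hII + X (v, 1) * h2

/-- The change of variables involves `i`, so scalars are first extended to the algebraic numbers,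
which preserves independence, and restricted to `ℚ` at the end. -/
lemma IsGenericConfig.algebraicIndependent_conjCoord {V : Type*}
    {p : V → EuclideanSpace ℝ (Fin 2)} (hp : IsGenericConfig p) :
    AlgebraicIndependent ℚ
      (fun c : V × Bool => conjCoord (fun v => planeToComplex (p v)) c.1 c.2) := by
  have h1 : AlgebraicIndependent ℤ (fun c : V × Fin 2 => ((p c.1 c.2 : ℝ) : ℂ)) :=
    AlgebraicIndependent.map' (f := (algebraMap ℝ ℂ).toIntAlgHom) hp Complex.ofReal_injective
  have h2 : AlgebraicIndependent ℚ (fun c : V × Fin 2 => ((p c.1 c.2 : ℝ) : ℂ)) :=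
    haveI : Algebra.IsAlgebraic ℤ ℚ := IsLocalization.isAlgebraic ℚ (nonZeroDivisors ℤ)
    h1.extendScalars ℚ
  have hIalg : IsAlgebraic ℚ Complex.I :=
    ⟨Polynomial.X ^ 2 + 1, (Polynomial.monic_X_pow_add_C 1 two_ne_zero).ne_zero, by simp⟩
  let E := algebraicClosure ℚ ℂ
  let I : E := ⟨Complex.I, mem_algebraicClosure_iff.2 hIalg⟩
  have h3 : AlgebraicIndependent E (fun c : V × Fin 2 => ((p c.1 c.2 : ℝ) : ℂ)) :=
    haveI : Algebra.IsAlgebraic ℚ E := algebraicClosure.isAlgebraic ℚ ℂ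
    h2.extendScalars E
  have hI : I * I = -1 := Subtype.ext Complex.I_mul_I
  have h4 := (h3.aeval_of_algebraicIndependent
    (algebraicIndependent_conj_substitution (V := V) I hI)).restrictScalars
      (algebraMap ℚ E).injective
  have h5 := h4.comp (fun c : V × Bool => (c.1, if c.2 then (0 : Fin 2) else 1)) (by
    rintro ⟨v, s⟩ ⟨w, t⟩ h
    cases s <;> cases t <;> simp_all)
  convert h5 using 1
  funext ⟨v, s⟩
  have hIm : algebraMap E ℂ I = Complex.I := rfl
  cases s <;>
    simp [planeToComplex, Complex.ext_iff, hIm]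

/-- The field generated over `ℚ` by all conjugate coordinates except the point `u` itself. -/
noncomputable def coordFieldExcept {V : Type*} (z : V → ℂ) (u : V) : IntermediateField ℚ ℂ :=
  IntermediateField.adjoin ℚ ((fun c : V × Bool => conjCoord z c.1 c.2) '' {(u, true)}ᶜ)

/-- `z u` is transcendental over the field of the remaining coordinates. That field still contains
the conjugate of `z u`, which acts as a separate variable. -/
lemma notMem_coordFieldExcept {V : Type*} {z : V → ℂ}
    (hz : AlgebraicIndependent ℚ (fun c : V × Bool => conjCoord z c.1 c.2)) (u : V) :
    z u ∉ coordFieldExcept z u := fun h =>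
  IntermediateField.transcendental_adjoin_iff.2
    (hz.transcendental_adjoin (s := {(u, true)}ᶜ) (i := (u, true)) (by simp))
    (isAlgebraic_algebraMap (⟨z u, h⟩ : coordFieldExcept z u))

lemma conjCoord_mem_coordFieldExcept {V : Type*} (z : V → ℂ) {u v : V} {s : Bool}
    (h : v ≠ u ∨ s = false) : conjCoord z v s ∈ coordFieldExcept z u :=
  IntermediateField.subset_adjoin _ _ ⟨(v, s), by
    rintro h'
    simp only [Set.mem_singleton_iff, Prod.mk.injEq] at h'
    rcases h with h | h <;> simp_all, rfl⟩

lemma AlgebraicIndependent.conjCoord_injective {V : Type*} {z : V → ℂ}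
    (hz : AlgebraicIndependent ℚ (fun c : V × Bool => conjCoord z c.1 c.2)) (s : Bool) :
    Function.Injective (fun v => conjCoord z v s) := fun v w h => by
  have := hz.injective (a₁ := (v, s)) (a₂ := (w, s)) h
  simpa using this

/-! ### Multiplicative independence of edge ratios -/

/-- The linear part of the reflection in the line through the points `z a` and `z b`, or its
conjugate. -/
noncomputable def edgeRatio {V : Type*} (z : V → ℂ) (a b : V) (s : Bool) : ℂ :=
  (conjCoord z a s - conjCoord z b s) / (conjCoord z a (!s) - conjCoord z b (!s))

open MvPolynomial in
/-- For a generic configuration the ratios of distinct edges are multiplicatively independent. -/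
lemma eq_empty_of_prod_edgeRatio_eq_one {V ι : Type*} [DecidableEq V] {z : V → ℂ}
    (hz : AlgebraicIndependent ℚ (fun c : V × Bool => conjCoord z c.1 c.2))
    (S : Finset ι) (a b : ι → V) (ε : ι → Bool) (hab : ∀ i ∈ S, a i ≠ b i)
    (hinj : ∀ i ∈ S, ∀ j ∈ S, ({a i, b i} : Finset V) = {a j, b j} → i = j)
    (h : ∏ i ∈ S, edgeRatio z (a i) (b i) (ε i) = 1) : S = ∅ := by
  by_contra hne
  obtain ⟨k, hk⟩ := Finset.nonempty_iff_ne_empty.2 hne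
  have hne' : ∀ i ∈ S, ∀ s, conjCoord z (a i) s - conjCoord z (b i) s ≠ 0 := fun i hi s =>
    sub_ne_zero.2 ((hz.conjCoord_injective s).ne (hab i hi))
  simp only [edgeRatio, Finset.prod_div_distrib] at h
  rw [div_eq_one_iff_eq (Finset.prod_ne_zero_iff.2 fun i hi => hne' i hi _)] at h
  have hP := (algebraicIndependent_iff.1 hz)
    (∏ i ∈ S, (X (a i, ε i) - X (b i, ε i)) - ∏ i ∈ S, (X (a i, !ε i) - X (b i, !ε i)))
    (by simp [map_prod, h])
  -- Identify the variable of `a k` with that of `b k` on the side `ε k` only. This kills the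
  -- numerator product, so some denominator factor `j` must vanish too. That forces edge `j` to be
  -- edge `k`, whose denominator lies on the untouched side.
  let y : V × Bool → ℂ := fun c => conjCoord z (if c = (a k, ε k) then b k else c.1) c.2
  have hy := congrArg (aeval y) hP
  simp only [map_sub, map_prod, aeval_X, map_zero] at hy
  rw [Finset.prod_eq_zero hk, zero_sub, neg_eq_zero, Finset.prod_eq_zero_iff] at hy
  · obtain ⟨j, hj, hjy⟩ := hy
    have h1 := hz.conjCoord_injective _ (sub_eq_zero.1 hjy)
    simp only [Prod.mk.injEq] at h1
    have hkj : j = k → False := by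
      rintro rfl
      simp only [Bool.not_eq_eq_eq_not, Bool.eq_not_self, and_false, if_false]
        at h1
      exact hab j hj h1
    have hj' := hab j hj
    apply hkj
    apply hinj j hj k hk
    split_ifs at h1 with h2 h3 h3
    · exact absurd (h2.1.trans h3.1.symm) hj'
    · rw [h2.1, ← h1]
    · rw [h3.1, h1, Finset.pair_comm]
    · exact absurd h1 hj'
  · have hbk : b k ≠ a k := (hab k hk).symm
    simp [y, hbk]

/-! ### Isometries and reflections of the plane -/

/-- Two points with equal distances to `A` and to `B` agree or are mirror images in `AB`. -/
lemma eq_or_eq_reflection {A B C D : ℂ} (hAB : A ≠ B) (h1 : ‖D - A‖ = ‖C - A‖)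
    (h2 : ‖D - B‖ = ‖C - B‖) :
    D = C ∨ D = A + (A - B) / (conj A - conj B) * (conj C - conj A) := by
  have hB : B - A ≠ 0 := sub_ne_zero.2 hAB.symm
  have hBc : conj B - conj A ≠ 0 := by
    rw [← map_sub]; exact (map_ne_zero _).2 hB
  -- In the coordinate sending `A` to `0` and `B` to `1`, the equal distances give equal real parts
  -- and imaginary parts equal up to sign.
  obtain ⟨r, hr⟩ : ∃ r, D = A + (B - A) * r := ⟨(D - A) / (B - A), by field_simp; ring⟩
  obtain ⟨s, hs⟩ : ∃ s, C = A + (B - A) * s := ⟨(C - A) / (B - A), by field_simp; ring⟩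
  have e1 : ‖r‖ = ‖s‖ := by
    rw [hr, hs, add_sub_cancel_left, add_sub_cancel_left, norm_mul, norm_mul] at h1
    exact mul_left_cancel₀ (norm_ne_zero_iff.2 hB) h1
  have e2 : ‖r - 1‖ = ‖s - 1‖ := by
    rw [hr, hs, show A + (B - A) * r - B = (B - A) * (r - 1) by ring,
      show A + (B - A) * s - B = (B - A) * (s - 1) by ring, norm_mul, norm_mul] at h2
    exact mul_left_cancel₀ (norm_ne_zero_iff.2 hB) h2
  have q1 : r.re * r.re + r.im * r.im = s.re * s.re + s.im * s.im := by
    have := congrArg (· ^ 2) e1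
    simpa [← Complex.normSq_eq_norm_sq, Complex.normSq_apply] using this
  have q2 : (r.re - 1) * (r.re - 1) + r.im * r.im = (s.re - 1) * (s.re - 1) + s.im * s.im := by
    have := congrArg (· ^ 2) e2
    simpa [← Complex.normSq_eq_norm_sq, Complex.normSq_apply] using this
  have hre : r.re = s.re := by linarith
  rw [hre] at q1
  rcases mul_self_eq_mul_self_iff.1 (add_left_cancel q1) with him | him
  · left
    rw [hr, hs, Complex.ext hre him]
  · right
    have hrs : r = conj s := Complex.ext (by simpa using hre) (by simpa using him)
    have hAB' : conj A - conj B ≠ 0 := by rw [← neg_sub]; exact neg_ne_zero.2 hBc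
    rw [hr, hs, hrs, map_add, map_mul, map_sub]
    field_simp
    ring

/-- A similarity of the plane of the form `ζ = α z + t` (or `ζ = α z̄ + t` if `s = false`) on
two points extends to a third one, possibly after reflecting in the line through the two. -/
lemma eq_or_eq_flip {V : Type*} {z ζ : V → ℂ} {a b c : V} {s : Bool} {α t : ℂ} (hα : ‖α‖ = 1)
    (hab : z a ≠ z b)
    (ha : ζ a = α * conjCoord z a s + t) (hb : ζ b = α * conjCoord z b s + t)
    (hca : ‖ζ c - ζ a‖ = ‖z c - z a‖) (hcb : ‖ζ c - ζ b‖ = ‖z c - z b‖) :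
    ζ c = α * conjCoord z c s + t ∨
    ζ c = α * (conjCoord z a s + edgeRatio z a b s *
      (conjCoord z c (!s) - conjCoord z a (!s))) + t := by
  have hα0 : α ≠ 0 := norm_ne_zero_iff.1 (by rw [hα]; exact one_ne_zero)
  have hn : ∀ v w, ‖conjCoord z v s - conjCoord z w s‖ = ‖z v - z w‖ := fun v w => by
    cases s
    · rw [conjCoord_false, conjCoord_false, ← map_sub, Complex.norm_conj]
    · rfl
  obtain ⟨D, hD⟩ : ∃ D, ζ c = α * D + t := ⟨(ζ c - t) / α, by field_simp; ring⟩
  have key : ∀ v, ζ v = α * conjCoord z v s + t → ‖ζ c - ζ v‖ = ‖D - conjCoord z v s‖ :=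
    fun v hv => by
      rw [hD, hv, add_sub_add_right_eq_sub, ← mul_sub, norm_mul, hα, one_mul]
  have hAB : conjCoord z a s ≠ conjCoord z b s := fun h => hab <| by
    have := hn a b
    rw [h, sub_self, norm_zero, eq_comm, norm_eq_zero, sub_eq_zero] at this
    exact this
  rcases eq_or_eq_reflection (C := conjCoord z c s) hAB
    ((key a ha).symm.trans (hca.trans (hn c a).symm))
    ((key b hb).symm.trans (hcb.trans (hn c b).symm)) with h | h
  · left; rw [hD, h]
  · right
    rw [hD, h]
    simp only [conj_conjCoord, edgeRatio]

lemma norm_edgeRatio {V : Type*} {z : V → ℂ} {a b : V} (h : z a ≠ z b) (s : Bool) :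
    ‖edgeRatio z a b s‖ = 1 := by
  have h' : ‖z a - z b‖ ≠ 0 := norm_ne_zero_iff.2 (sub_ne_zero.2 h)
  have h2 : ‖conj (z a) - conj (z b)‖ = ‖z a - z b‖ := by rw [← map_sub, Complex.norm_conj]
  cases s <;> simp [edgeRatio, h2, h']

lemma conj_edgeRatio {V : Type*} (z : V → ℂ) (a b : V) (s : Bool) :
    conj (edgeRatio z a b s) = edgeRatio z a b (!s) := by
  simp [edgeRatio]

/-- Equal side lengths of a triangle give an isometry between its two realizations. -/
lemma exists_isometry_of_triangle {V : Type*} {z ζ : V → ℂ} {a b c : V} (hab : z a ≠ z b)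
    (hba : ‖ζ a - ζ b‖ = ‖z a - z b‖) (hca : ‖ζ c - ζ a‖ = ‖z c - z a‖)
    (hcb : ‖ζ c - ζ b‖ = ‖z c - z b‖) :
    ∃ (s : Bool) (α t : ℂ), ‖α‖ = 1 ∧ ζ a = α * conjCoord z a s + t ∧
      ζ b = α * conjCoord z b s + t ∧ ζ c = α * conjCoord z c s + t := by
  have h0 : z a - z b ≠ 0 := sub_ne_zero.2 hab
  set α := (ζ a - ζ b) / (z a - z b) with hα
  have hα1 : ‖α‖ = 1 := by
    rw [hα, norm_div, hba, div_self (norm_ne_zero_iff.2 h0)]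
  have ha : ζ a = α * conjCoord z a true + (ζ a - α * z a) := by simp
  have hb : ζ b = α * conjCoord z b true + (ζ a - α * z a) := by
    rw [conjCoord_true, hα]; field_simp; ring
  rcases eq_or_eq_flip hα1 hab ha hb hca hcb with h | h
  · exact ⟨true, α, _, hα1, ha, hb, h⟩
  -- If the direct isometry misses `c`, precompose it with the reflection in the line through `z a`
  -- and `z b`.
  · have hr : edgeRatio z a b true * (conjCoord z a false - conjCoord z b false) =
        z a - z b := by
      have : conj (z a) - conj (z b) ≠ 0 := by rw [← map_sub]; exact (map_ne_zero _).2 h0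
      simp only [edgeRatio, conjCoord_true, Bool.not_true, conjCoord_false]
      field_simp
    refine ⟨false, α * edgeRatio z a b true,
      α * (z a - edgeRatio z a b true * conjCoord z a false) + (ζ a - α * z a), ?_, ?_, ?_, ?_⟩
    · rw [norm_mul, hα1, norm_edgeRatio hab, one_mul]
    · ring
    · rw [hb, conjCoord_true]; linear_combination α * hr
    · rw [h, conjCoord_true, Bool.not_true]; ring

/-! ### Folding along a strip -/

/-- Unfolding a strip of triangles: if `z` and `ζ` have the same edge lengths on the triangles
`T 0, …, T m` and agree on `T 0`, then `ζ` is on each `T k` the image of `z` under an isometry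
whose linear part is a product of ratios of distinct shared edges, namely of those at which the
strip is folded. -/
lemma exists_folding {V : Type*} [DecidableEq V] {z ζ : V → ℂ} (hz : Function.Injective z)
    {m : ℕ} {T : ℕ → Finset V} {a b : ℕ → V} (hcard : ∀ i ≤ m, (T i).card = 3)
    (hab : ∀ i < m, a i ≠ b i) (hT : ∀ i < m, T i ∩ T (i + 1) = {a i, b i})
    (hd : ∀ i ≤ m, ∀ u ∈ T i, ∀ v ∈ T i, ‖ζ u - ζ v‖ = ‖z u - z v‖)
    (h0 : ∀ v ∈ T 0, ζ v = z v) {k : ℕ} (hk : k ≤ m) :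
    ∃ (S : Finset ℕ) (ε : ℕ → Bool) (s : Bool) (α t : ℂ), S ⊆ Finset.range k ∧ ‖α‖ = 1 ∧
      (∀ v ∈ T k, ζ v = α * conjCoord z v s + t) ∧
      α = ∏ i ∈ S, edgeRatio z (a i) (b i) (ε i) ∧
      (S = ∅ → ∀ j ≤ k, ∀ v ∈ T j, ζ v = z v) ∧
      (S = ∅ → s = true ∧ t = 0) ∧
      ∀ K : IntermediateField ℚ ℂ,
        (∀ i < k, ∀ s, conjCoord z (a i) s ∈ K ∧ conjCoord z (b i) s ∈ K) →
        (α ∈ K ∧ conj α ∈ K) ∧ t ∈ K ∧ conj t ∈ K := by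
  induction k with
  | zero =>
    refine ⟨∅, fun _ => true, true, 1, 0, by simp, by simp, by simpa using h0, by simp, ?_,
      by simp, fun K _ => by simp [K.one_mem, K.zero_mem]⟩
    rintro - j hj
    rw [Nat.le_zero.1 hj]
    exact h0
  | succ k ih =>
    obtain ⟨S, ε, s, α, t, hS, hα, hTk, hprod, hempty, hempty', hK⟩ := ih (by omega)
    have hkm : k < m := hk
    have hinter := hT k hkm
    have ha : a k ∈ T k ∧ a k ∈ T (k + 1) := Finset.mem_inter.1 (by rw [hinter]; simp)
    have hb : b k ∈ T k ∧ b k ∈ T (k + 1) := Finset.mem_inter.1 (by rw [hinter]; simp)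
    have hkab := hab k hkm
    obtain ⟨c, hc⟩ : ∃ c, T (k + 1) = {a k, b k, c} := by
      have h1 : ({a k, b k} : Finset V) ⊆ T (k + 1) := hinter ▸ Finset.inter_subset_right
      have h2 : (T (k + 1) \ {a k, b k}).card = 1 := by
        rw [Finset.card_sdiff_of_subset h1, hcard _ hk, Finset.card_pair hkab]
      obtain ⟨c, hc⟩ := Finset.card_eq_one.1 h2
      refine ⟨c, ?_⟩
      rw [← Finset.union_sdiff_of_subset h1, hc, Finset.insert_union, Finset.singleton_union]
    have hcT : c ∈ T (k + 1) := by rw [hc]; simp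
    have hza := hTk _ ha.1
    have hzb := hTk _ hb.1
    rcases eq_or_eq_flip hα (hz.ne hkab) hza hzb (hd _ hk _ hcT _ ha.2) (hd _ hk _ hcT _ hb.2)
      with h | h
    · have hTk' : ∀ v ∈ T (k + 1), ζ v = α * conjCoord z v s + t := by
        intro v hv
        rw [hc] at hv
        simp only [Finset.mem_insert, Finset.mem_singleton] at hv
        rcases hv with rfl | rfl | rfl <;> assumption
      refine ⟨S, ε, s, α, t, hS.trans (Finset.range_mono (Nat.le_succ k)), hα, hTk', hprod, ?_,
        hempty', fun K hKm => hK K fun i hi => hKm i (hi.trans (Nat.lt_succ_self k))⟩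
      intro hS0 j hj v hv
      rcases Nat.le_succ_iff.1 hj with hj | rfl
      · exact hempty hS0 j hj v hv
      -- With no folds so far, the isometry is the identity; this is why the induction also records
      -- `s` and `t`.
      · obtain ⟨rfl, rfl⟩ := hempty' hS0
        rw [hTk' v hv, hprod, hS0]
        simp
    · have hkS : k ∉ S := fun hkS => absurd (hS hkS) (by simp)
      have hratio : edgeRatio z (a k) (b k) s *
          (conjCoord z (a k) (!s) - conjCoord z (b k) (!s)) =
          conjCoord z (a k) s - conjCoord z (b k) s := by
        refine div_mul_cancel₀ _ (sub_ne_zero.2 fun h => hkab (hz ?_))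
        have h' := h
        cases s
        · exact h'
        · exact (starRingEnd ℂ).injective h'
      have hcongr : ∏ i ∈ S, edgeRatio z (a i) (b i) (Function.update ε k s i) =
          ∏ i ∈ S, edgeRatio z (a i) (b i) (ε i) :=
        Finset.prod_congr rfl fun i hi => by
          rw [Function.update_of_ne (by rintro rfl; exact hkS hi)]
      -- A fold at edge `k` precomposes with the reflection in it: `s` flips, and the new factor
      -- takes its exponent sign from the orientation `s` before the fold.
      refine ⟨insert k S, Function.update ε k s, !s, α * edgeRatio z (a k) (b k) s,
        α * (conjCoord z (a k) s - edgeRatio z (a k) (b k) s * conjCoord z (a k) (!s)) + t,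
        ?_, ?_, ?_, ?_, fun h => absurd h (Finset.insert_ne_empty _ _),
        fun h => absurd h (Finset.insert_ne_empty _ _), fun K hKm => ?_⟩
      · rw [Finset.range_add_one]
        exact Finset.insert_subset_insert _ hS
      · rw [norm_mul, hα, norm_edgeRatio (hz.ne hkab), one_mul]
      · intro v hv
        rw [hc] at hv
        simp only [Finset.mem_insert, Finset.mem_singleton] at hv
        rcases hv with rfl | rfl | rfl
        · rw [hza]; ring
        · rw [hzb]; linear_combination α * hratio
        · rw [h]; ring
      · rw [Finset.prod_insert hkS, Function.update_self, hcongr, ← hprod, mul_comm]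
      · obtain ⟨⟨h1, h2⟩, h3, h4⟩ := hK K fun i hi => hKm i (hi.trans (Nat.lt_succ_self k))
        have hmem := fun s => (hKm k (Nat.lt_succ_self k) s).1
        have hr : ∀ s, edgeRatio z (a k) (b k) s ∈ K := fun s =>
          K.div_mem (K.sub_mem (hmem _) (hKm k (Nat.lt_succ_self k) s).2)
            (K.sub_mem (hmem _) (hKm k (Nat.lt_succ_self k) _).2)
        simp only [map_mul, map_add, map_sub, conj_edgeRatio, conj_conjCoord]
        exact ⟨⟨K.mul_mem h1 (hr _), K.mul_mem h2 (hr _)⟩,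
          K.add_mem (K.mul_mem h1 (K.sub_mem (hmem _) (K.mul_mem (hr _) (hmem _)))) h3,
          K.add_mem (K.mul_mem h2 (K.sub_mem (hmem _) (K.mul_mem (hr _) (hmem _)))) h4⟩

/-! ### Conditions that force a trivial linear part -/

section Rigidity

variable {V : Type*} {z : V → ℂ} {s : Bool} {α t : ℂ}

/-- An isometry that fixes a point independent of its coefficients is a translation. -/
lemma eq_one_of_fixes (hz : AlgebraicIndependent ℚ (fun c : V × Bool => conjCoord z c.1 c.2))
    {x : V} (hα : α ∈ coordFieldExcept z x) (ht : t ∈ coordFieldExcept z x)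
    (hx : z x = α * conjCoord z x s + t) : α = 1 := by
  by_contra hne
  apply notMem_coordFieldExcept hz x
  -- If orientation is reversed, the equation expresses `z x` through its conjugate and the
  -- coefficients; if it is preserved and `α ≠ 1`, then `z x = t / (1 - α)`. Both contradict
  -- independence.
  cases s
  · rw [hx]
    exact add_mem (mul_mem hα (conjCoord_mem_coordFieldExcept z (Or.inr rfl))) ht
  · have : z x = t / (1 - α) := by
      rw [eq_div_iff (sub_ne_zero.2 (Ne.symm hne))]
      rw [conjCoord_true] at hx
      linear_combination hx
    rw [this]
    exact div_mem ht (sub_mem (one_mem _) hα)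

/-- An isometry that moves a point `y` independent of its coefficients, and keeps the distance of
`y` to a further point `x`, fixes `x`. -/
lemma fixes_of_norm_sub_eq
    (hz : AlgebraicIndependent ℚ (fun c : V × Bool => conjCoord z c.1 c.2)) {x y : V}
    (hxy : x ≠ y) (hα1 : ‖α‖ = 1)
    (hα : α ∈ coordFieldExcept z y) (hα' : conj α ∈ coordFieldExcept z y)
    (ht : t ∈ coordFieldExcept z y) (ht' : conj t ∈ coordFieldExcept z y)
    (h : ‖α * conjCoord z y s + t - z x‖ = ‖z y - z x‖) :
    z x = α * conjCoord z x s + t := by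
  have hsq : (α * conjCoord z y s + t - z x) *
      (conj α * conjCoord z y (!s) + conj t - conj (z x)) =
      (z y - z x) * (conj (z y) - conj (z x)) := by
    have := congrArg (fun r : ℝ => ((r ^ 2 : ℝ) : ℂ)) h
    simp only [Complex.ofReal_pow, ← Complex.mul_conj'] at this
    simpa only [map_sub, map_add, map_mul, conj_conjCoord] using this
  have hαα : α * conj α = 1 := by rw [Complex.mul_conj', hα1]; simp
  have hx : z x ∈ coordFieldExcept z y := conjCoord_mem_coordFieldExcept z (s := true) (.inl hxy)
  have hx' : conj (z x) ∈ coordFieldExcept z y :=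
    conjCoord_mem_coordFieldExcept z (s := false) (.inl hxy)
  have hy' : conj (z y) ∈ coordFieldExcept z y :=
    conjCoord_mem_coordFieldExcept z (s := false) (.inr rfl)
  -- The squared distance equation is linear in `z y`, its conjugate being a scalar of the field.
  -- The `z y * conj (z y)` terms cancel since `α * conj α = 1`, so the remaining coefficient of `z
  -- y` vanishes, which says that `z x` is fixed.
  have hlin : ∀ A ∈ coordFieldExcept z y, ∀ B ∈ coordFieldExcept z y, A * z y = B → A = 0 := by
    intro A hA B hB hAB
    by_contra hA0
    apply notMem_coordFieldExcept hz y
    rw [(eq_div_iff hA0).2 ((mul_comm _ _).trans hAB)]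
    exact div_mem hB hA
  cases s
  · simp only [conjCoord_false, conjCoord_true, Bool.not_false] at hsq ⊢
    have hA := hlin (conj α * (t - z x) + conj (z x))
      (add_mem (mul_mem hα' (sub_mem ht hx)) hx')
      (-(α * conj (z y) + t - z x) * (conj t - conj (z x)) - z x * (conj (z y) - conj (z x)))
      (sub_mem (mul_mem (neg_mem (sub_mem (add_mem (mul_mem hα hy') ht) hx)) (sub_mem ht' hx'))
        (mul_mem hx (sub_mem hy' hx')))
      (by linear_combination hsq - z y * conj (z y) * hαα)
    linear_combination -α * hA + (t - z x) * hαα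
  · simp only [conjCoord_false, conjCoord_true, Bool.not_true] at hsq ⊢
    have hA := hlin (α * (conj t - conj (z x)) + conj (z x))
      (add_mem (mul_mem hα (sub_mem ht' hx')) hx')
      (-(t - z x) * (conj α * conj (z y) + conj t - conj (z x))
        - z x * (conj (z y) - conj (z x)))
      (sub_mem (mul_mem (neg_mem (sub_mem ht hx))
        (sub_mem (add_mem (mul_mem hα' hy') ht') hx')) (mul_mem hx (sub_mem hy' hx')))
      (by linear_combination hsq - z y * conj (z y) * hαα)
    have hA' := congrArg conj hA
    simp only [map_add, map_mul, map_sub, Complex.conj_conj, map_zero] at hA'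
    linear_combination -α * hA' + (t - z x) * hαα

/-- An isometry that fixes three points of a generic configuration is the identity. -/
lemma eq_one_of_fixes_three
    (hz : AlgebraicIndependent ℚ (fun c : V × Bool => conjCoord z c.1 c.2)) {u v w : V}
    (huv : u ≠ v) (huw : u ≠ w) (hvw : v ≠ w)
    (hu : z u = α * conjCoord z u s + t) (hv : z v = α * conjCoord z v s + t)
    (hw : z w = α * conjCoord z w s + t) : α = 1 := by
  have hne := fun s => sub_ne_zero.2 ((hz.conjCoord_injective s).ne huv)
  cases s
  · exfalso
    apply notMem_coordFieldExcept hz w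
    simp only [conjCoord_false] at hu hv hw hne
    have h1 := hne false
    simp only [conjCoord_false] at h1
    -- Fixed points of an orientation-reversing isometry are collinear, and collinearity determines
    -- `z w` from its conjugate and the other two points.
    have : z w = z u - (conj (z u) - conj (z w)) * (z u - z v) / (conj (z u) - conj (z v)) := by
      rw [eq_sub_iff_add_eq, ← eq_sub_iff_add_eq', div_eq_iff h1]
      linear_combination (conj (z u) - conj (z w)) * (hu - hv) -
        (conj (z u) - conj (z v)) * (hu - hw)
    rw [this]
    have hm : ∀ x s, (x ≠ w ∨ s = false) → conjCoord z x s ∈ coordFieldExcept z w :=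
      fun x s => conjCoord_mem_coordFieldExcept z
    have hu1 := hm u true (.inl huw)
    have hv1 := hm v true (.inl hvw)
    have hu2 := hm u false (.inr rfl)
    have hv2 := hm v false (.inr rfl)
    have hw2 := hm w false (.inr rfl)
    exact sub_mem hu1 (div_mem (mul_mem (sub_mem hu2 hw2) (sub_mem hu1 hv1)) (sub_mem hu2 hv2))
  · refine mul_right_cancel₀ (hne true) ?_
    simp only [conjCoord_true] at hu hv ⊢
    linear_combination hv - hu

end Rigidity

/-! ### Rigidity of strips -/

/-- A strip of triangles with distinct shared edges is rigid, up to isometry, as soon as some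
further condition forces the isometry accumulated along the strip to be a translation. -/
lemma norm_sub_eq_of_strip {V : Type*} [DecidableEq V] {z ζ : V → ℂ}
    (hz : AlgebraicIndependent ℚ (fun c : V × Bool => conjCoord z c.1 c.2))
    {m : ℕ} {T : ℕ → Finset V} (hcard : ∀ i ≤ m, (T i).card = 3)
    (hshare : ∀ i < m, (T i ∩ T (i + 1)).card = 2)
    (hinj : ∀ i < m, ∀ j < m, T i ∩ T (i + 1) = T j ∩ T (j + 1) → i = j)
    (hcover : ∀ v, ∃ i ≤ m, v ∈ T i)
    (hd : ∀ i ≤ m, ∀ u ∈ T i, ∀ v ∈ T i, ‖ζ u - ζ v‖ = ‖z u - z v‖)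
    (key : ∀ ζ' : V → ℂ, (∀ u v, ‖ζ' u - ζ' v‖ = ‖ζ u - ζ v‖) → (∀ v ∈ T 0, ζ' v = z v) →
      ∀ (s : Bool) (α t : ℂ), ‖α‖ = 1 → (∀ v ∈ T m, ζ' v = α * conjCoord z v s + t) →
      (∀ K : IntermediateField ℚ ℂ, (∀ i < m, ∀ v ∈ T i ∩ T (i + 1), ∀ s, conjCoord z v s ∈ K) →
        (α ∈ K ∧ conj α ∈ K) ∧ t ∈ K ∧ conj t ∈ K) → α = 1) (u v : V) :
    ‖ζ u - ζ v‖ = ‖z u - z v‖ := by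
  have hzinj : Function.Injective z := hz.conjCoord_injective true
  obtain ⟨A, B, C, hAB, -, -, hABC⟩ := Finset.card_eq_three.1 (hcard 0 (Nat.zero_le m))
  have hA : A ∈ T 0 := by simp [hABC]
  have hB : B ∈ T 0 := by simp [hABC]
  have hC : C ∈ T 0 := by simp [hABC]
  have hd0 := hd 0 (Nat.zero_le m)
  have hζAB : ζ A ≠ ζ B := fun h => hAB <| hzinj <| by
    have := hd0 A hA B hB
    rwa [h, sub_self, norm_zero, eq_comm, norm_eq_zero, sub_eq_zero] at this
  -- The roles of `z` and `ζ` are exchanged: the isometry carries `ζ` back to `z` on the initial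
  -- triangle.
  obtain ⟨r, β, w, hβ, h1, h2, h3⟩ := exists_isometry_of_triangle (z := ζ) (ζ := z) (c := C) hζAB
    (hd0 A hA B hB).symm (hd0 C hC A hA).symm (hd0 C hC B hB).symm
  set ζ' : V → ℂ := fun v => β * conjCoord ζ v r + w with hζ'
  have hdist : ∀ u v, ‖ζ' u - ζ' v‖ = ‖ζ u - ζ v‖ := fun u v => by
    rw [hζ', add_sub_add_right_eq_sub, ← mul_sub, norm_mul, hβ, one_mul]
    cases r
    · rw [conjCoord_false, conjCoord_false, ← map_sub, Complex.norm_conj]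
    · rfl
  have h0 : ∀ v ∈ T 0, ζ' v = z v := by
    intro v hv
    rw [hABC] at hv
    simp only [Finset.mem_insert, Finset.mem_singleton] at hv
    rcases hv with rfl | rfl | rfl
    exacts [h1.symm, h2.symm, h3.symm]
  have hex : ∀ i, ∃ a b, i < m → a ≠ b ∧ T i ∩ T (i + 1) = {a, b} := fun i => by
    by_cases hi : i < m
    · obtain ⟨a, b, h⟩ := Finset.card_eq_two.1 (hshare i hi)
      exact ⟨a, b, fun _ => h⟩
    -- Dummy endpoints past the end of the strip.
    · exact ⟨u, u, fun h => absurd h hi⟩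
  choose a b hab using hex
  obtain ⟨S, ε, s, α, t, hS, hα, hTm, hprod, hempty, -, hK⟩ := exists_folding hzinj hcard
    (fun i hi => (hab i hi).1) (fun i hi => (hab i hi).2)
    (fun i hi u hu v hv => (hdist u v).trans (hd i hi u hu v hv)) h0 le_rfl
  have hα1 := key ζ' hdist h0 s α t hα hTm fun K hKm => hK K fun i hi s => by
    have := hKm i hi
    rw [(hab i hi).2] at this
    exact ⟨this _ (by simp) s, this _ (by simp) s⟩
  have hlt : ∀ i ∈ S, i < m := fun i hi => Finset.mem_range.1 (hS hi)
  have hS0 := eq_empty_of_prod_edgeRatio_eq_one hz S a b ε (fun i hi => (hab i (hlt i hi)).1)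
    (fun i hi j hj h => hinj i (hlt i hi) j (hlt j hj) <| by
      rw [(hab i (hlt i hi)).2, (hab j (hlt j hj)).2, h]) (hprod.symm.trans hα1)
  have hall : ∀ v, ζ' v = z v := fun v => by
    obtain ⟨i, hi, hv⟩ := hcover v
    exact hempty hS0 i hi v hv
  rw [← hdist, hall, hall]

/-! ### Cycles, circuits and bridges -/

section Stream

variable {V : Type*} {n : ℕ} {T : Fin (n + 1) → Finset V}

/-- The sequence of triangles of a stream, continued periodically. -/
def periodicTriangles (T : Fin (n + 1) → Finset V) (i : ℕ) : Finset V := T (Fin.ofNat (n + 1) i)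

lemma periodicTriangles_of_lt {i : ℕ} (hi : i < n + 1) :
    periodicTriangles T i = T ⟨i, hi⟩ :=
  congrArg T (Fin.ext (Nat.mod_eq_of_lt hi))

lemma periodicTriangles_last : periodicTriangles T n = T (Fin.last n) :=
  periodicTriangles_of_lt (Nat.lt_succ_self n)

lemma periodicTriangles_zero : periodicTriangles T 0 = T 0 :=
  periodicTriangles_of_lt (Nat.succ_pos n)

lemma periodicTriangles_succ_self : periodicTriangles T (n + 1) = T 0 :=
  congrArg T (Fin.ext (Nat.mod_self (n + 1)))

lemma Covers.exists_periodicTriangles (hT : Covers T) (v : V) :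
    ∃ i ≤ n, v ∈ periodicTriangles T i := by
  obtain ⟨i, hi⟩ := hT v
  refine ⟨i, Nat.lt_succ_iff.1 i.2, ?_⟩
  rwa [periodicTriangles_of_lt i.2]

lemma norm_sub_eq_of_sameEdgeLengths {G : SimpleGraph V} {p q : V → EuclideanSpace ℝ (Fin 2)}
    (h : SameEdgeLengths G p q) {u v : V} (huv : u = v ∨ G.Adj u v) :
    ‖planeToComplex (q u) - planeToComplex (q v)‖ =
      ‖planeToComplex (p u) - planeToComplex (p v)‖ := by
  rcases huv with rfl | huv
  · simp
  · rw [← dist_eq_norm_planeToComplex, ← dist_eq_norm_planeToComplex, h u v huv]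

lemma eq_or_adj_of_unionGraph_le {G : SimpleGraph V} (hG : unionGraph T ≤ G) {i : ℕ} {u v : V}
    (hu : u ∈ periodicTriangles T i) (hv : v ∈ periodicTriangles T i) : u = v ∨ G.Adj u v :=
  or_iff_not_imp_left.2 fun huv => hG ⟨huv, _, hu, hv⟩

variable [DecidableEq V]

lemma periodicTriangles_inter {i : ℕ} (hi : i < n) :
    periodicTriangles T i ∩ periodicTriangles T (i + 1) =
      T (Fin.castSucc ⟨i, hi⟩) ∩ T (Fin.succ ⟨i, hi⟩) := by
  rw [periodicTriangles_of_lt (hi.trans (Nat.lt_succ_self n)),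
    periodicTriangles_of_lt (Nat.succ_lt_succ hi)]
  rfl

lemma IsTriangleStream.periodicTriangles_inter_inj (hT : IsTriangleStream T) {i j : ℕ}
    (hi : i < n) (hj : j < n)
    (h : periodicTriangles T i ∩ periodicTriangles T (i + 1) =
      periodicTriangles T j ∩ periodicTriangles T (j + 1)) : i = j := by
  rw [periodicTriangles_inter hi, periodicTriangles_inter hj] at h
  exact congrArg Fin.val (hT.share_distinct h)

/-- A node of a single triangle lies on no edge shared by consecutive triangles. -/
lemma notMem_inter_of_only {x : V} {k : Fin (n + 1)} (hx : ∀ i, x ∈ T i → i = k) (i : Fin n) :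
    x ∉ T i.castSucc ∩ T i.succ := fun h => by
  rw [Finset.mem_inter] at h
  have := (hx _ h.1).trans (hx _ h.2).symm
  exact absurd this (Fin.castSucc_lt_succ (i := i)).ne

/-- A graph containing a covering stream of triangles is globally rigid if its edge lengths force
the isometry accumulated along the stream to be a translation. -/
lemma IsTriangleStream.genericallyGloballyRigid {G : SimpleGraph V} (hT : IsTriangleStream T)
    (hcov : Covers T) (hG : unionGraph T ≤ G)
    (key : ∀ z ζ : V → ℂ, AlgebraicIndependent ℚ (fun c : V × Bool => conjCoord z c.1 c.2) →
      (∀ u v, G.Adj u v → ‖ζ u - ζ v‖ = ‖z u - z v‖) → (∀ v ∈ T 0, ζ v = z v) →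
      ∀ (s : Bool) (α t : ℂ), ‖α‖ = 1 →
      (∀ v ∈ T (Fin.last n), ζ v = α * conjCoord z v s + t) →
      (∀ K : IntermediateField ℚ ℂ,
        (∀ i : Fin n, ∀ v ∈ T i.castSucc ∩ T i.succ, ∀ s, conjCoord z v s ∈ K) →
        (α ∈ K ∧ conj α ∈ K) ∧ t ∈ K ∧ conj t ∈ K) → α = 1) :
    GenericallyGloballyRigid G := by
  intro p q hp hpq u v
  have hz := hp.algebraicIndependent_conjCoord
  rw [dist_eq_norm_planeToComplex, dist_eq_norm_planeToComplex, eq_comm]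
  refine norm_sub_eq_of_strip hz (m := n) (T := periodicTriangles T)
    (ζ := fun v => planeToComplex (q v)) (fun i _ => hT.card_eq _)
    (fun i hi => by rw [periodicTriangles_inter hi]; exact hT.share _)
    (fun i hi j hj => hT.periodicTriangles_inter_inj hi hj) hcov.exists_periodicTriangles
    (fun i _ u hu v hv =>
      norm_sub_eq_of_sameEdgeLengths hpq (eq_or_adj_of_unionGraph_le hG hu hv)) ?_ u v
  intro ζ' hζ' h0 s α t hα hlast hK
  rw [periodicTriangles_zero] at h0
  rw [periodicTriangles_last] at hlast
  refine key _ ζ' hz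
    (fun u v huv => (hζ' u v).trans (norm_sub_eq_of_sameEdgeLengths hpq (.inr huv)))
    h0 s α t hα hlast fun K hKm => hK K fun i hi v hv => ?_
  rw [periodicTriangles_inter hi] at hv
  exact hKm _ v hv

lemma IsCycleStream.genericallyGloballyRigid (hT : IsCycleStream T) (hcov : Covers T) :
    GenericallyGloballyRigid (unionGraph T) := by
  intro p q hp hpq u v
  have hz := hp.algebraicIndependent_conjCoord
  rw [dist_eq_norm_planeToComplex, dist_eq_norm_planeToComplex, eq_comm]
  have hclose : periodicTriangles T n ∩ periodicTriangles T (n + 1) = T (Fin.last n) ∩ T 0 := by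
    rw [periodicTriangles_last, periodicTriangles_succ_self]
  -- The strip is one triangle longer than the stream: it ends with `T 0` again, so the closing edge
  -- counts as a possible fold, and `close_ne` keeps the fold edges distinct.
  refine norm_sub_eq_of_strip hz (m := n + 1) (T := periodicTriangles T)
    (ζ := fun v => planeToComplex (q v)) (fun i _ => hT.stream.card_eq _)
    (fun i hi => ?_) (fun i hi j hj h => ?_)
    (fun v => (hcov.exists_periodicTriangles v).imp fun i hi => ⟨hi.1.trans (Nat.le_succ n), hi.2⟩)
    (fun i _ u hu v hv =>
      norm_sub_eq_of_sameEdgeLengths hpq (eq_or_adj_of_unionGraph_le le_rfl hu hv)) ?_ u v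
  · rcases Nat.lt_succ_iff_lt_or_eq.1 hi with hi | rfl
    · rw [periodicTriangles_inter hi]; exact hT.stream.share _
    · rw [hclose]; exact hT.close
  · rcases Nat.lt_succ_iff_lt_or_eq.1 hi with hi | rfl <;>
      rcases Nat.lt_succ_iff_lt_or_eq.1 hj with hj | rfl
    · exact hT.stream.periodicTriangles_inter_inj hi hj h
    · rw [hclose, periodicTriangles_inter hi] at h
      exact absurd h.symm (hT.close_ne _)
    · rw [hclose, periodicTriangles_inter hj] at h
      exact absurd h (hT.close_ne _)
    · rfl
  · intro ζ' _ h0 s α t _ hlast _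
    rw [periodicTriangles_zero] at h0
    rw [periodicTriangles_succ_self] at hlast
    obtain ⟨A, B, C, hAB, hAC, hBC, hABC⟩ := Finset.card_eq_three.1 (hT.stream.card_eq 0)
    have hfix := fun v hv => (h0 v hv).symm.trans (hlast v hv)
    exact eq_one_of_fixes_three hz hAB hAC hBC (hfix A (by simp [hABC])) (hfix B (by simp [hABC]))
      (hfix C (by simp [hABC]))

/-- The isometry accumulated along a stream is defined over the field of all coordinates but those
of a node off the shared edges. -/
lemma mem_coordFieldExcept_of_notMem_inter {z : V → ℂ} {α t : ℂ} {x : V}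
    (hx : ∀ i : Fin n, x ∉ T i.castSucc ∩ T i.succ)
    (hK : ∀ K : IntermediateField ℚ ℂ,
      (∀ i : Fin n, ∀ v ∈ T i.castSucc ∩ T i.succ, ∀ s, conjCoord z v s ∈ K) →
        (α ∈ K ∧ conj α ∈ K) ∧ t ∈ K ∧ conj t ∈ K) :
    (α ∈ coordFieldExcept z x ∧ conj α ∈ coordFieldExcept z x) ∧
      t ∈ coordFieldExcept z x ∧ conj t ∈ coordFieldExcept z x :=
  hK _ fun i v hv _ => conjCoord_mem_coordFieldExcept z <| .inl <| by
    rintro rfl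
    exact hx i hv

/-- The knot could lie on a shared edge only if the first and last triangles were consecutive, so
that there are just two. The last would then contain both `x` and the edge opposite to it in the
first, making the two equal. -/
lemma IsCircuitStream.notMem_inter {x : V} (hT : IsCircuitStream T x) (i : Fin n) :
    x ∉ T i.castSucc ∩ T i.succ := fun h => by
  rw [Finset.mem_inter] at h
  have h0 : i.castSucc = 0 := (hT.only _ h.1).resolve_right (Fin.castSucc_lt_last i).ne
  have h1 : i.succ = Fin.last n := (hT.only _ h.2).resolve_left (Fin.succ_ne_zero i)
  obtain ⟨hx0, j, hj, hsub⟩ := hT.first.1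
  have hj' : j = Fin.last n := by
    have e0 := congrArg Fin.val h0
    have e1 := congrArg Fin.val h1
    simp only [Fin.val_castSucc, Fin.val_zero, Fin.val_succ, Fin.val_last] at e0 e1
    have := Fin.val_ne_of_ne hj
    rw [Fin.val_zero] at this
    ext
    rw [Fin.val_last]
    omega
  subst hj'
  rw [h1] at h
  have h01 : T 0 ⊆ T (Fin.last n) := by
    rw [← Finset.insert_erase hx0]
    exact Finset.insert_subset h.2 hsub
  have := Finset.eq_of_subset_of_card_le h01 (by rw [hT.stream.card_eq, hT.stream.card_eq])
  exact hj (hT.stream.distinct this).symm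

lemma IsCircuitStream.genericallyGloballyRigid {x : V} (hT : IsCircuitStream T x)
    (hcov : Covers T) : GenericallyGloballyRigid (unionGraph T) := by
  refine hT.stream.genericallyGloballyRigid hcov le_rfl ?_
  intro z ζ hz _ h0 s α t _ hlast hK
  obtain ⟨⟨hα, -⟩, ht, -⟩ := mem_coordFieldExcept_of_notMem_inter hT.notMem_inter hK
  exact eq_one_of_fixes hz hα ht ((h0 x hT.first.1.1).symm.trans (hlast x hT.last.1.1))

lemma IsChainStream.genericallyGloballyRigid {a b : V} (hT : IsChainStream T a b)
    (hcov : Covers T) : GenericallyGloballyRigid (unionGraph T ⊔ SimpleGraph.edge a b) := by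
  refine hT.stream.genericallyGloballyRigid hcov le_sup_left ?_
  intro z ζ hz hd h0 s α t hα1 hlast hK
  obtain ⟨⟨hα, -⟩, ht, -⟩ :=
    mem_coordFieldExcept_of_notMem_inter (notMem_inter_of_only hT.first_only) hK
  obtain ⟨⟨hα', hα''⟩, ht', ht''⟩ :=
    mem_coordFieldExcept_of_notMem_inter (notMem_inter_of_only hT.last_only) hK
  refine eq_one_of_fixes hz hα ht
    (fixes_of_norm_sub_eq (s := s) hz hT.ne hα1 hα' hα'' ht' ht'' ?_)
  -- The only use of the added edge: the image of `b` keeps its distance to `a`, which lies in the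
  -- initial triangle and has not moved.
  have := hd b a (Or.inr ((SimpleGraph.edge_adj a b b a).2 ⟨.inr ⟨rfl, rfl⟩, hT.ne.symm⟩))
  rwa [h0 a hT.first.1.1, hlast b hT.last.1.1] at this

end Stream

theorem lemma3 {V : Type*} [DecidableEq V] (G : SimpleGraph V) :
    (IsTriangleCycle G → GenericallyGloballyRigid G) ∧
    (IsTriangleCircuit G → GenericallyGloballyRigid G) ∧
    (IsTriangleBridge G → GenericallyGloballyRigid G) := by
  refine ⟨?_, ?_, ?_⟩
  · rintro ⟨n, T, hT, hcov, rfl⟩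
    exact hT.genericallyGloballyRigid hcov
  · rintro ⟨n, T, x, hT, hcov, rfl⟩
    exact hT.genericallyGloballyRigid hcov
  · rintro ⟨n, T, a, b, hT, hcov, rfl⟩
    exact hT.genericallyGloballyRigid hcov
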